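/- A binary DFA with $n$ states consists of a set $Q$ of $n$ states, an alphabet $\Sigma$ of $2$ symbols, and a total transition function $Q\times\Sigma\to Q$, $(q,x)\mapsto qx$, extended to words $w\in\Sigma^*$ and to subsets $S\subseteq Q$ by $Sw=\{qw : q\in S\}$. A word $w$ synchronizes $S$ if $|Sw|=1$. A state $q$ is a sink state if $qx=q$ for all $x\in\Sigma$. The DFA is called transitive up to $2$ sink states if it has exactly two sink states and, for every state $q$ that is not a sink state and every state $q'$, there is a word $w$ with $qw=q'$. Theorem. There are, for all sufficiently large $n$, a binary DFA $M_n$ with $n$ states that is transitive up to $2$ sink states and a subset $S_n$ of its states, such that $S_n$ is synchronized by some word and the length $L(n)$ of a shortest word synchronizing $S_n$ satisfies $$L(n)=\Omega\big((3-\varepsilon)^{n/3}\big)\quad\text{as } n\to\infty,\ \text{for every } 0<\varepsilon<3,$$ where the implied constant may depend on $\varepsilon$. In particular $L(n)=\Omega(1.4422^n)$. -/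

import Mathlib

open Filter Asymptotics

/-- A (complete) DFA `(Q, Σ, ·)` in the sense of synchronization theory: a total transition
function, without initial or final states. -/
structure SyncDFA (Q A : Type) where
  /-- the state `q · x` -/
  step : Q → A → Q

namespace SyncDFA

variable {Q A : Type}

/-- The state `q w` reached from `q` by reading the word `w` from left to right. -/
def run (M : SyncDFA Q A) (q : Q) (w : List A) : Q :=
  w.foldl M.step q

/-- The subset `S w = {q w | q ∈ S}`. -/
def runSet (M : SyncDFA Q A) (S : Set Q) (w : List A) : Set Q :=
  (fun q => M.run q w) '' S

/-- `M` is synchronizing on `S` in `l` steps: some word `w` of length `l` makes `S w` a set of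
size 1. -/
def SynchronizesIn (M : SyncDFA Q A) (S : Set Q) (l : ℕ) : Prop :=
  ∃ w : List A, w.length = l ∧ (M.runSet S w).ncard = 1

/-- `l` is the length of a shortest word that synchronizes `S` (in particular there is one). -/
def IsSyncLength (M : SyncDFA Q A) (S : Set Q) (l : ℕ) : Prop :=
  IsLeast {m : ℕ | M.SynchronizesIn S m} l

/-- A sink state is fixed by every symbol. -/
def IsSink (M : SyncDFA Q A) (q : Q) : Prop :=
  ∀ x : A, M.step q x = q

/-- `M` is transitive up to `m` sink states: it has exactly `m` sink states, and from every other
state every state can be reached. -/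
def TransitiveUpToSinks (M : SyncDFA Q A) (m : ℕ) : Prop :=
  {q : Q | M.IsSink q}.ncard = m ∧
    ∀ q q' : Q, ¬ M.IsSink q → ∃ w : List A, M.run q w = q'

end SyncDFA

/-! ### Runs, sinks and relabelling of states -/

namespace SyncDFA

variable {Q Q' A : Type}

/-! The automaton simulates a ternary counter at three states per digit, so `n` states hold about `n
/ 3` digits. Tokens circulate with period `k + 4`; in each round token `i` reads the letters at
offsets `i` and `i + 1`, as carry in and carry out, so neighbouring tokens share a letter. A token
given inconsistent carries falls into the sink `dead`. The other sink belongs to the set, so no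
token may die and the word is forced to be a valid carry pattern.

A token can leave for the good sink only on letters `1, 0, 1`. If token `i + 1` is on its belt, the
last two letters kill it, so only the top token can leave first, and it needs a carry, hence `3 ^ (k
- 1)` rounds (`three_pow_le_of_orbit`). Conversely, counting up releases the top token and resets
the others to zero; repeating this synchronizes the set (`exists_synchronizing_word`). -/

theorem run_append (M : SyncDFA Q A) (q : Q) (u v : List A) :
    M.run q (u ++ v) = M.run (M.run q u) v := by
  simp [run]

/-- The state reached from `q` after reading the first `t` letters of the sequence `x`. -/
def orbit (M : SyncDFA Q A) (x : ℕ → A) (q : Q) : ℕ → Q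
  | 0 => q
  | t + 1 => M.step (M.orbit x q t) (x t)

theorem run_map_range (M : SyncDFA Q A) (x : ℕ → A) (q : Q) (t : ℕ) :
    M.run q ((List.range t).map x) = M.orbit x q t := by
  induction t with
  | zero => rfl
  | succ t ih => rw [List.range_succ, List.map_append, run_append, ih]; rfl

theorem run_eq_of_isSink {M : SyncDFA Q A} {q : Q} (hq : M.IsSink q) (w : List A) :
    M.run q w = q := by
  induction w with
  | nil => rfl
  | cons a w ih => simpa [run, hq a] using ih

theorem orbit_eq_of_isSink {M : SyncDFA Q A} {x : ℕ → A} {q s : Q} (hs : M.IsSink s) {t t' : ℕ}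
    (h : M.orbit x q t = s) (htt : t ≤ t') : M.orbit x q t' = s := by
  induction t', htt using Nat.le_induction with
  | base => exact h
  | succ t' _ ih => rw [orbit, ih, hs]

/-- Transport of a DFA along a bijection of the states. -/
def congr (e : Q ≃ Q') (M : SyncDFA Q A) : SyncDFA Q' A :=
  ⟨fun q a => e (M.step (e.symm q) a)⟩

theorem run_congr (e : Q ≃ Q') (M : SyncDFA Q A) (q : Q) (w : List A) :
    (M.congr e).run (e q) w = e (M.run q w) := by
  induction w generalizing q with
  | nil => rfl
  | cons a w ih => simpa [run, congr] using ih (M.step q a)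

theorem isSink_congr (e : Q ≃ Q') (M : SyncDFA Q A) (q : Q) :
    (M.congr e).IsSink (e q) ↔ M.IsSink q := by
  simp [IsSink, congr]

theorem synchronizesIn_congr (e : Q ≃ Q') (M : SyncDFA Q A) (S : Set Q) (l : ℕ) :
    (M.congr e).SynchronizesIn (e '' S) l ↔ M.SynchronizesIn S l := by
  have h (w : List A) : (M.congr e).runSet (e '' S) w = e '' M.runSet S w := by
    simp only [runSet, Set.image_image, run_congr]
  simp only [SynchronizesIn, h, Set.ncard_image_of_injective _ e.injective]

theorem TransitiveUpToSinks.congr (e : Q ≃ Q') {M : SyncDFA Q A} {m : ℕ}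
    (h : M.TransitiveUpToSinks m) : (M.congr e).TransitiveUpToSinks m := by
  refine ⟨?_, fun q q' hq => ?_⟩
  · have : {q | (M.congr e).IsSink q} = e '' {q | M.IsSink q} := by
      ext q
      obtain ⟨q, rfl⟩ := e.surjective q
      simp [isSink_congr]
    rw [this, Set.ncard_image_of_injective _ e.injective, h.1]
  · obtain ⟨q, rfl⟩ := e.surjective q
    obtain ⟨q', rfl⟩ := e.surjective q'
    rw [isSink_congr] at hq
    obtain ⟨w, hw⟩ := h.2 q q' hq
    exact ⟨w, by rw [run_congr, hw]⟩

end SyncDFA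

/-! ### The counter automaton -/

/-- States of a ternary counter with `k` digits. A digit is a token on a conveyor belt; at the end
of the belt it reads two letters in the gate, where it is updated. -/
inductive CounterState (k r : ℕ) : Type
  | belt (j : Fin (k + 3)) (d : Fin 3)
  | gate (x : Fin 2) (d : Fin 3)
  | bumped (e : Fin 2)
  | drain (j : Fin (r + 1))
  | dead

namespace CounterState

variable {k r : ℕ}

def equivSum (k r : ℕ) : CounterState k r ≃
    (Fin (k + 3) × Fin 3) ⊕ (Fin 2 × Fin 3) ⊕ Fin 2 ⊕ Fin (r + 1) ⊕ Unit where
  toFun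
    | belt j d => .inl (j, d)
    | gate x d => .inr (.inl (x, d))
    | bumped e => .inr (.inr (.inl e))
    | drain j => .inr (.inr (.inr (.inl j)))
    | dead => .inr (.inr (.inr (.inr ())))
  invFun
    | .inl (j, d) => belt j d
    | .inr (.inl (x, d)) => gate x d
    | .inr (.inr (.inl e)) => bumped e
    | .inr (.inr (.inr (.inl j))) => drain j
    | .inr (.inr (.inr (.inr _))) => dead
  left_inv q := by cases q <;> rfl
  right_inv q := by rcases q with q | q | q | q | q <;> rfl

theorem nonempty_equiv_fin {k r n : ℕ} (h : n = 3 * k + 19 + r) :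
    Nonempty (CounterState k r ≃ Fin n) := by
  refine ⟨(equivSum k r).trans (Fintype.equivFinOfCardEq ?_)⟩
  simp only [Fintype.card_sum, Fintype.card_prod, Fintype.card_fin, Fintype.card_unit]
  omega

/-- A token with digit `d` that reads `x` and `y` gets the digit `d + x - 3 * y`, and dies if this
is not a digit. -/
def gateStep (x : Fin 2) (d : Fin 3) (y : Fin 2) : CounterState k r :=
  if x = 0 then (if y = 0 then belt 0 d else dead)
  else if y = 0 then (if d = 0 then bumped 0 else if d = 1 then bumped 1 else dead)
  else (if d = 2 then belt 0 0 else dead)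

/-- `bumped e` stands in for belt position 0 after an increment without carry; it is the only
entrance to the drain. The return from the drain on `0` serves transitivity, and the drain length
`r` adjusts the number of states modulo 3. -/
def step : CounterState k r → Fin 2 → CounterState k r
  | belt j d, x => if h : j.val + 1 < k + 3 then belt ⟨j + 1, h⟩ d else gate x d
  | gate x d, y => gateStep x d y
  | bumped e, x => if x = 0 then belt 1 e.succ else drain 0
  | drain j, x => if h : j.val + 1 < r + 1 then (if x = 1 then drain ⟨j + 1, h⟩ else belt 0 0)
      else drain j
  | dead, _ => dead

end CounterState

open CounterState

def counterDFA (k r : ℕ) : SyncDFA (CounterState k r) (Fin 2) := ⟨CounterState.step⟩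

namespace CounterState

variable {k r : ℕ}

/-- The initial position of the `i`-th digit. -/
def start (k r i : ℕ) (d : Fin 3) : CounterState k r := belt ⟨k + 2 - i, by omega⟩ d

/-- Including the sink fixes the state at which every token must end. -/
def startSet (k r : ℕ) : Set (CounterState k r) :=
  insert (drain (Fin.last r)) {q | ∃ i < k, start k r i 0 = q}

theorem isSink_dead : (counterDFA k r).IsSink dead := fun _ => rfl

theorem isSink_drain_last : (counterDFA k r).IsSink (drain (Fin.last r)) := fun _ => by
  simp [counterDFA, step]

theorem isSink_iff (q : CounterState k r) :
    (counterDFA k r).IsSink q ↔ q = drain (Fin.last r) ∨ q = dead := by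
  refine ⟨fun h => ?_, ?_⟩
  · have h1 := h 1
    simp only [counterDFA] at h1
    cases q with
    | belt j d =>
      simp only [step] at h1
      split_ifs at h1
      simp [Fin.ext_iff] at h1
    | gate x d =>
      simp only [step, gateStep] at h1
      split_ifs at h1
    | bumped e => simp [step] at h1
    | drain j =>
      simp only [step] at h1
      split_ifs at h1 with h2
      · simp [Fin.ext_iff] at h1
      · left
        congr 1
        ext
        simp
        omega
    | dead => simp
  · rintro (rfl | rfl)
    exacts [isSink_drain_last, isSink_dead]

/-! ### One round of a single token -/

section Orbit

variable {x : ℕ → Fin 2} {q : CounterState k r}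

theorem orbit_belt {s j : ℕ} {hj : j < k + 3} {d : Fin 3}
    (h : (counterDFA k r).orbit x q s = belt ⟨j, hj⟩ d) (l : ℕ) (hl : j + l < k + 3) :
    (counterDFA k r).orbit x q (s + l) = belt ⟨j + l, hl⟩ d := by
  induction l with
  | zero => exact h
  | succ l ih =>
    rw [← add_assoc, SyncDFA.orbit, ih (by omega)]
    simp only [counterDFA, step]
    rw [dif_pos (by omega)]
    rfl

theorem orbit_gate {s i : ℕ} (hi : i ≤ k + 2) {d : Fin 3}
    (h : (counterDFA k r).orbit x q s = start k r i d) :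
    (counterDFA k r).orbit x q (s + i + 2) = gateStep (x (s + i)) d (x (s + i + 1)) := by
  have h1 := orbit_belt h i (by omega)
  rw [SyncDFA.orbit, SyncDFA.orbit, h1]
  simp only [counterDFA, step]
  rw [dif_neg (by omega)]

theorem orbit_dead {s i : ℕ} (hi : i ≤ k + 2) {d : Fin 3}
    (h : (counterDFA k r).orbit x q s = start k r i d)
    (hd : ∀ d' : Fin 3, d.val + (x (s + i)).val ≠ d'.val + 3 * (x (s + i + 1)).val) :
    (counterDFA k r).orbit x q (s + i + 2) = dead := by
  rw [orbit_gate hi h]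
  revert hd
  generalize x (s + i) = u
  generalize x (s + i + 1) = v
  clear h
  intro hd
  simp only [gateStep]
  have h0 := hd d
  have h1 := hd 0
  have h2 := hd 1
  have h3 := hd 2
  fin_cases u <;> fin_cases v <;> fin_cases d <;> simp_all

theorem orbit_round {s i : ℕ} (hi : i < k) {d d' : Fin 3}
    (h : (counterDFA k r).orbit x q s = start k r i d)
    (hd : d.val + (x (s + i)).val = d'.val + 3 * (x (s + i + 1)).val)
    (hx : x (s + i) = 1 → x (s + i + 1) = 0 → x (s + i + 2) = 0) :
    (counterDFA k r).orbit x q (s + (k + 4)) = start k r i d' := by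
  have h1 : (counterDFA k r).orbit x q (s + i + 3) = belt 1 d' := by
    rw [SyncDFA.orbit, orbit_gate (by omega) h]
    revert hd hx
    generalize x (s + i) = u
    generalize x (s + i + 1) = v
    generalize x (s + i + 2) = z
    clear h
    intro hd hx
    simp only [gateStep, counterDFA]
    fin_cases u <;> fin_cases v <;> fin_cases d <;> fin_cases d' <;> simp_all [step]
  have h2 := orbit_belt (j := 1) (hj := by omega) h1 (k + 1 - i) (by omega)
  rw [show s + (k + 4) = s + i + 3 + (k + 1 - i) by omega, h2, start]
  congr 2
  omega

theorem orbit_drain {s i : ℕ} (hi : i ≤ k + 2) {d : Fin 3} (hd : d ≠ 2)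
    (h : (counterDFA k r).orbit x q s = start k r i d)
    (h0 : x (s + i) = 1) (h1 : x (s + i + 1) = 0)
    (h2 : ∀ j ≤ r, x (s + i + 2 + j) = 1) :
    (counterDFA k r).orbit x q (s + i + 3 + r) = drain (Fin.last r) := by
  have key : ∀ j (hj : j ≤ r),
      (counterDFA k r).orbit x q (s + i + 3 + j) = drain ⟨j, by omega⟩ := by
    intro j
    induction j with
    | zero =>
      intro _
      have := h2 0 (by omega)
      rw [add_zero] at this
      rw [add_zero, SyncDFA.orbit, orbit_gate hi h, h0, h1, this]
      fin_cases d <;> simp_all [gateStep, counterDFA, step]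
    | succ j ih =>
      intro hj
      have := h2 (j + 1) hj
      rw [← add_assoc, SyncDFA.orbit, ih (by omega),
        show s + i + 3 + j = s + i + 2 + (j + 1) by omega, this]
      simp only [counterDFA, step]
      rw [dif_pos (by omega)]
      simp
  exact key r le_rfl

end Orbit

end CounterState

/-! ### The lower bound -/

namespace CounterState

variable {k r : ℕ}

theorem three_pow_le_of_orbit (hk : 0 < k) {x : ℕ → Fin 2}
    (hdead : ∀ i < k, ∀ t, (counterDFA k r).orbit x (start k r i 0) t ≠ dead) {T : ℕ}
    (hT : (counterDFA k r).orbit x (start k r 0 0) T = drain (Fin.last r)) :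
    3 ^ (k - 1) ≤ T := by
  -- `c i N` counts the carries into digit `i` during the first `N` rounds.
  set c : ℕ → ℕ → ℕ := fun i N => ∑ n ∈ Finset.range N, (x (n * (k + 4) + i)).val with hc
  have hcs (i N : ℕ) : c i (N + 1) = c i N + (x (N * (k + 4) + i)).val :=
    Finset.sum_range_succ _ _
  have key : ∀ N < 3 ^ (k - 1), ∀ i < k, ∃ d : Fin 3,
      (counterDFA k r).orbit x (start k r i 0) (N * (k + 4)) = start k r i d ∧
        c i N = d.val + 3 * c (i + 1) N := by
    intro N
    induction N with
    | zero => exact fun _ i _ => ⟨0, by simp [SyncDFA.orbit], by simp [hc]⟩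
    | succ N ih =>
      intro hN
      have ih := ih (by omega)
      have hnext : ∀ i < k, ∀ d : Fin 3,
          (counterDFA k r).orbit x (start k r i 0) (N * (k + 4)) = start k r i d →
          ∃ d' : Fin 3, d.val + (x (N * (k + 4) + i)).val =
            d'.val + 3 * (x (N * (k + 4) + i + 1)).val := by
        intro i hi d h
        by_contra! hd
        exact hdead i hi _ (orbit_dead (by omega) h hd)
      have hcount : ∀ i < k, 3 * c (i + 1) (N + 1) ≤ c i (N + 1) := by
        intro i hi
        obtain ⟨d, h1, h2⟩ := ih i hi
        obtain ⟨d', h3⟩ := hnext i hi d h1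
        rw [hcs, hcs, h2, ← add_assoc (N * (k + 4)) i 1]
        omega
      have hpow : ∀ i ≤ k, 3 ^ i * c i (N + 1) ≤ N + 1 := by
        intro i
        induction i with
        | zero =>
          intro _
          have h : c 0 (N + 1) ≤ ∑ _n ∈ Finset.range (N + 1), 1 :=
            Finset.sum_le_sum fun n _ => by omega
          simpa using h
        | succ i IH =>
          intro hi
          calc 3 ^ (i + 1) * c (i + 1) (N + 1) = 3 ^ i * (3 * c (i + 1) (N + 1)) := by ring
            _ ≤ 3 ^ i * c i (N + 1) := Nat.mul_le_mul_left _ (hcount i (by omega))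
            _ ≤ N + 1 := IH (by omega)
      intro i hi
      obtain ⟨d, h1, h2⟩ := ih i hi
      obtain ⟨d', h3⟩ := hnext i hi d h1
      refine ⟨d', ?_, ?_⟩
      · rw [add_one_mul]
        refine orbit_round hi h1 h3 fun hu hv => ?_
        by_contra hz
        have hz : x (N * (k + 4) + i + 2) = 1 := by omega
        -- A letter `1` here would drain token `i`. Below the top, token `i + 1` would then carry
        -- out without a carry in; at the top, a carry has arrived too early.
        by_cases hik : i + 1 < k
        · obtain ⟨d₁, h4, -⟩ := ih (i + 1) hik
          obtain ⟨d₂, h5⟩ := hnext (i + 1) hik d₁ h4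
          rw [← add_assoc, hv, add_assoc _ 1 1, hz] at h5
          simp only [Fin.val_zero, Fin.val_one] at h5
          omega
        · have h6 := hpow i hi.le
          rw [hcs, hu, show i = k - 1 by omega] at h6
          have h7 : 3 ^ (k - 1) * 1 ≤
              3 ^ (k - 1) * (c (k - 1) N + ((1 : Fin 2) : ℕ)) :=
            Nat.mul_le_mul_left _ (by simp)
          omega
      · rw [hcs, hcs, h2, ← add_assoc (N * (k + 4)) i 1]
        omega
  -- After `T` full rounds, which end no earlier than time `T`, token 0 would still be on the belt.
  by_contra! hlt
  obtain ⟨d, h, -⟩ := key T hlt 0 hk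
  have h' := SyncDFA.orbit_eq_of_isSink isSink_drain_last hT
    (Nat.le_mul_of_pos_right T (Nat.succ_pos (k + 3)))
  rw [h'] at h
  simp [start] at h

theorem three_pow_le_of_synchronizesIn (hk : 0 < k) {l : ℕ}
    (h : (counterDFA k r).SynchronizesIn (startSet k r) l) : 3 ^ (k - 1) ≤ l := by
  obtain ⟨w, rfl, hw⟩ := h
  obtain ⟨s, hs⟩ := Set.ncard_eq_one.1 hw
  have hrun : ∀ q ∈ startSet k r, (counterDFA k r).run q w = s := fun q hq => by
    have : (counterDFA k r).run q w ∈ (counterDFA k r).runSet (startSet k r) w := ⟨q, hq, rfl⟩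
    rwa [hs] at this
  have hsink := hrun _ (Set.mem_insert _ _)
  rw [SyncDFA.run_eq_of_isSink isSink_drain_last] at hsink
  subst hsink
  have hw' : w = (List.range w.length).map fun t => w.getD t 0 := by
    refine List.ext_getElem (by simp) fun t h1 h2 => ?_
    simp [h1]
  have horb : ∀ i < k, (counterDFA k r).orbit (fun t => w.getD t 0) (start k r i 0) w.length =
      drain (Fin.last r) := fun i hi => by
    rw [← SyncDFA.run_map_range, ← hw']
    exact hrun _ (Set.mem_insert_of_mem _ ⟨i, hi, rfl⟩)
  refine three_pow_le_of_orbit hk (fun i hi t ht => ?_) (horb 0 hk)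
  -- Both sinks absorb, so at the later of the two times the token would be in both.
  have h1 := SyncDFA.orbit_eq_of_isSink isSink_dead ht (le_max_left t w.length)
  have h2 := SyncDFA.orbit_eq_of_isSink isSink_drain_last (horb i hi) (le_max_right t w.length)
  rw [h1] at h2
  cases h2

/-! ### Existence of a synchronizing word -/

/-- The letter at time `t` of a word that counts up the `h + 1` lowest digits. -/
def countWord (k h t : ℕ) : Fin 2 :=
  if h + 1 < t % (k + 4) ∨ 3 ^ (t % (k + 4)) ∣ t / (k + 4) + 1 then 1 else 0

theorem countWord_apply {h i N : ℕ} (hi : i < k + 4) :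
    countWord k h (N * (k + 4) + i) = if h + 1 < i ∨ 3 ^ i ∣ N + 1 then 1 else 0 := by
  have h1 : (N * (k + 4) + i) % (k + 4) = i := by
    rw [mul_comm, Nat.mul_add_mod, Nat.mod_eq_of_lt hi]
  have h2 : (N * (k + 4) + i) / (k + 4) = N := by
    rw [mul_comm, Nat.mul_add_div (by omega), Nat.div_eq_of_lt hi, add_zero]
  rw [countWord, h1, h2]

/-- Passing from `N` to `N + 1` carries into digit `i` exactly when `3 ^ i ∣ N + 1`. -/
theorem digit_succ (N i : ℕ) :
    N / 3 ^ i % 3 + (if 3 ^ i ∣ N + 1 then 1 else 0) =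
      (N + 1) / 3 ^ i % 3 + 3 * (if 3 ^ (i + 1) ∣ N + 1 then 1 else 0) := by
  have h1 : (N + 1) / 3 ^ i = _ := Nat.succ_div
  have h2 : (N + 1) / 3 ^ (i + 1) = _ := Nat.succ_div
  rw [pow_succ, ← Nat.div_div_eq_div_mul, ← Nat.div_div_eq_div_mul] at h2
  rw [pow_succ]
  omega

def digit (N i : ℕ) : Fin 3 := ⟨N / 3 ^ i % 3, Nat.mod_lt _ (by norm_num)⟩

/-- The last round, ending at `N = 3 ^ h`, is excluded for digit `h`, which drains there. -/
theorem orbit_countWord {h i : ℕ} (hh : h < k) (hi : i ≤ h) {N : ℕ}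
    (hN : N < 3 ^ h ∨ N = 3 ^ h ∧ i < h) :
    (counterDFA k r).orbit (countWord k h) (start k r i 0) (N * (k + 4)) =
      start k r i (digit N i) := by
  induction N with
  | zero => simp [SyncDFA.orbit, digit]
  | succ N ih =>
    rw [add_one_mul]
    refine orbit_round (by omega) (ih (by omega)) ?_ ?_
    · rw [add_assoc, countWord_apply (by omega), countWord_apply (by omega)]
      have := digit_succ N i
      simp only [show ¬ h + 1 < i by omega, show ¬ h + 1 < i + 1 by omega, false_or, digit]
      split_ifs at this ⊢ <;> simpa using this
    · rw [add_assoc, add_assoc, countWord_apply (by omega), countWord_apply (by omega),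
        countWord_apply (by omega)]
      simp only [show ¬ h + 1 < i by omega, show ¬ h + 1 < i + 1 by omega, false_or]
      intro h1 h2
      have h3 : ¬ 3 ^ (i + 1) ∣ N + 1 := fun h3 => by simp [h3] at h2
      have h4 : ¬ 3 ^ (i + 2) ∣ N + 1 := fun h4 =>
        h3 ((pow_dvd_pow 3 (by omega)).trans h4)
      have h5 : i < h := by
        by_contra h5
        obtain rfl : i = h := by omega
        have h6 : 3 ^ i ∣ N + 1 := by
          by_contra h6
          simp [h6] at h1
        have := Nat.le_of_dvd (by omega) h6
        omega
      simp [h4, show ¬ h + 1 < i + 2 by omega]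

theorem orbit_countWord_of_lt {h i : ℕ} (hh : h < k) (hi : i < h) :
    (counterDFA k r).orbit (countWord k h) (start k r i 0) (3 ^ h * (k + 4)) =
      start k r i 0 := by
  rw [orbit_countWord hh hi.le (Or.inr ⟨rfl, hi⟩)]
  congr 1
  ext
  simp only [digit, Nat.pow_div hi.le (by norm_num : 0 < 3)]
  rw [show h - i = (h - i - 1) + 1 by omega, pow_succ]
  simp

theorem orbit_countWord_self (hr : r ≤ 2) {h : ℕ} (hh : h < k) :
    (counterDFA k r).orbit (countWord k h) (start k r h 0) (3 ^ h * (k + 4)) =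
      drain (Fin.last r) := by
  have hpos : 0 < 3 ^ h := by positivity
  obtain ⟨B, hB⟩ : ∃ B, 3 ^ h = B + 1 := ⟨3 ^ h - 1, by omega⟩
  have h1 := orbit_countWord (r := r) hh le_rfl (N := B) (Or.inl (by omega))
  have hd : digit B h = 0 := by
    ext
    simp [digit, Nat.div_eq_of_lt (show B < 3 ^ h by omega)]
  rw [hd] at h1
  refine SyncDFA.orbit_eq_of_isSink isSink_drain_last
    (orbit_drain (by omega) (by decide) h1 ?_ ?_ fun j hj => ?_) ?_
  · rw [countWord_apply (by omega), if_pos (Or.inr (by rw [hB]))]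
  · rw [add_assoc, countWord_apply (by omega), if_neg]
    rintro (h2 | h2)
    · omega
    · have := Nat.le_of_dvd (by omega) h2
      rw [pow_succ] at this
      omega
  -- The offsets `h + 2 + j` stay within the round because `h < k` and `j ≤ r ≤ 2`.
  · rw [add_assoc, add_assoc, countWord_apply (by omega), if_pos (Or.inl (by omega))]
  · rw [hB, add_one_mul]
    omega

theorem exists_synchronizing_word (hr : r ≤ 2) {h : ℕ} (hh : h ≤ k) :
    ∃ w, ∀ i < h, (counterDFA k r).run (start k r i 0) w = drain (Fin.last r) := by
  induction h with
  | zero => exact ⟨[], by simp⟩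
  | succ h ih =>
    obtain ⟨w, hw⟩ := ih (by omega)
    refine ⟨(List.range (3 ^ h * (k + 4))).map (countWord k h) ++ w, fun i hi => ?_⟩
    rw [SyncDFA.run_append, SyncDFA.run_map_range]
    rcases Nat.lt_succ_iff_lt_or_eq.1 hi with hi | rfl
    · rw [orbit_countWord_of_lt (by omega) hi, hw i hi]
    · rw [orbit_countWord_self hr (by omega), SyncDFA.run_eq_of_isSink isSink_drain_last]

theorem exists_isSyncLength (hr : r ≤ 2) :
    ∃ l, (counterDFA k r).IsSyncLength (startSet k r) l := by
  obtain ⟨w, hw⟩ := exists_synchronizing_word (k := k) hr le_rfl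
  have hne : {m | (counterDFA k r).SynchronizesIn (startSet k r) m}.Nonempty := by
    refine ⟨w.length, w, rfl, Set.ncard_eq_one.2 ⟨drain (Fin.last r), ?_⟩⟩
    refine Set.Subset.antisymm ?_ (Set.singleton_subset_iff.2
      ⟨_, Set.mem_insert _ _, SyncDFA.run_eq_of_isSink isSink_drain_last w⟩)
    rintro _ ⟨q, rfl | ⟨i, hi, rfl⟩, rfl⟩
    exacts [SyncDFA.run_eq_of_isSink isSink_drain_last w, hw i hi]
  exact ⟨_, Nat.sInf_mem hne, fun m hm => Nat.sInf_le hm⟩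

/-! ### Transitivity, with `belt 0 0` as hub -/

/-- Some word leads from `q` to `q'`. -/
def Reach (q q' : CounterState k r) : Prop := ∃ w, (counterDFA k r).run q w = q'

theorem Reach.trans {q₁ q₂ q₃ : CounterState k r} (h : Reach q₁ q₂) (h' : Reach q₂ q₃) :
    Reach q₁ q₃ := by
  obtain ⟨u, rfl⟩ := h
  obtain ⟨v, rfl⟩ := h'
  exact ⟨u ++ v, SyncDFA.run_append _ _ _ _⟩

theorem Reach.of_step {q q' : CounterState k r} (a : Fin 2) (h : q.step a = q') : Reach q q' :=
  ⟨[a], h⟩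

theorem reach_belt {j : ℕ} (hj : j < k + 3) (d : Fin 3) (l : ℕ) (hl : j + l < k + 3) :
    Reach (belt ⟨j, hj⟩ d : CounterState k r) (belt ⟨j + l, hl⟩ d) :=
  ⟨_, (SyncDFA.run_map_range _ (fun _ => 0) _ l).trans
    (by simpa using orbit_belt (x := fun _ => 0) (s := 0) (SyncDFA.orbit.eq_1 _ _ _) l hl)⟩

theorem reach_gate (j : Fin (k + 3)) (d : Fin 3) (x : Fin 2) :
    Reach (belt j d : CounterState k r) (gate x d) := by
  have hj : j.val + (k + 2 - j) < k + 3 := by omega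
  refine (reach_belt j.2 d (k + 2 - j) hj).trans (Reach.of_step x ?_)
  simp only [step]
  rw [dif_neg (show ¬ j.val + (k + 2 - j) + 1 < k + 3 by omega)]

theorem reach_belt_zero (j : Fin (k + 3)) (d : Fin 3) :
    Reach (belt j d : CounterState k r) (belt 0 d) :=
  (reach_gate j d 0).trans (Reach.of_step 0 (by simp [step, gateStep]))

theorem reach_bumped_zero : Reach (belt 0 0 : CounterState k r) (bumped 0) :=
  (reach_gate 0 0 1).trans (Reach.of_step 0 (by simp [step, gateStep]))

theorem reach_of_bumped (e : Fin 2) : Reach (bumped e : CounterState k r) (belt 0 e.succ) :=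
  (Reach.of_step 0 (by simp [step])).trans (reach_belt_zero 1 _)

theorem reach_bumped_one : Reach (belt 0 1 : CounterState k r) (bumped 1) :=
  (reach_gate 0 1 1).trans (Reach.of_step 0 (by simp [step, gateStep]))

theorem reach_zero_two : Reach (belt 0 2 : CounterState k r) (belt 0 0) :=
  (reach_gate 0 2 1).trans (Reach.of_step 1 (by simp [step, gateStep]))

theorem reach_digit (d : Fin 3) : Reach (belt 0 0 : CounterState k r) (belt 0 d) := by
  have h1 : Reach (belt 0 0 : CounterState k r) (belt 0 1) :=
    reach_bumped_zero.trans (reach_of_bumped 0)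
  have h2 : Reach (belt 0 1 : CounterState k r) (belt 0 2) :=
    reach_bumped_one.trans (reach_of_bumped 1)
  fin_cases d
  exacts [⟨[], rfl⟩, h1, h1.trans h2]

theorem reach_origin (d : Fin 3) : Reach (belt 0 d : CounterState k r) (belt 0 0) := by
  have h2 : Reach (belt 0 1 : CounterState k r) (belt 0 0) :=
    (reach_bumped_one.trans (reach_of_bumped 1)).trans reach_zero_two
  fin_cases d
  exacts [⟨[], rfl⟩, h2, reach_zero_two]

theorem reach_from_origin (q : CounterState k r) : Reach (belt 0 0) q := by
  have hdrain : ∀ j (hj : j < r + 1), Reach (belt 0 0 : CounterState k r) (drain ⟨j, hj⟩) := by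
    intro j
    induction j with
    | zero => exact fun _ => reach_bumped_zero.trans (Reach.of_step 1 (by simp [step]))
    | succ j ih => exact fun hj => (ih (by omega)).trans (Reach.of_step 1 (by simp [step, hj]))
  cases q with
  | belt j d =>
    refine (reach_digit d).trans ?_
    have := reach_belt (k := k) (r := r) (j := 0) (by omega) d j (by omega)
    simpa using this
  | gate x d => exact (reach_digit d).trans (reach_gate 0 d x)
  | bumped e =>
    fin_cases e
    exacts [reach_bumped_zero, (reach_digit 1).trans reach_bumped_one]
  | drain j => exact hdrain j j.2
  | dead => exact (reach_gate 0 0 0).trans (Reach.of_step 1 (by simp [step, gateStep]))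

theorem reach_to_origin (q : CounterState k r) (hq : ¬ (counterDFA k r).IsSink q) :
    Reach q (belt 0 0) := by
  have hb (e : Fin 2) : Reach (bumped e : CounterState k r) (belt 0 0) :=
    (reach_of_bumped e).trans (reach_origin _)
  rw [isSink_iff, not_or] at hq
  cases q with
  | belt j d => exact (reach_belt_zero j d).trans (reach_origin d)
  | gate x d =>
    fin_cases x
    · exact (Reach.of_step 0 (by simp [step, gateStep])).trans (reach_origin d)
    · fin_cases d
      · exact (Reach.of_step 0 (by simp [step, gateStep])).trans (hb 0)
      · exact (Reach.of_step 0 (by simp [step, gateStep])).trans (hb 1)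
      · exact Reach.of_step 1 (by simp [step, gateStep])
  | bumped e => exact hb e
  | drain j =>
    have : j.val + 1 < r + 1 := by
      have h1 : j ≠ Fin.last r := fun h => hq.1 (by rw [h])
      have h2 : j.val ≠ r := fun h => h1 (Fin.ext h)
      omega
    refine Reach.of_step 0 ?_
    simp only [step]
    rw [dif_pos this, if_neg (by decide)]
  | dead => exact absurd rfl hq.2

theorem transitiveUpToSinks : (counterDFA k r).TransitiveUpToSinks 2 := by
  refine ⟨?_, fun q q' hq => (reach_to_origin q hq).trans (reach_from_origin q')⟩
  have : {q | (counterDFA k r).IsSink q} = {drain (Fin.last r), dead} := by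
    ext q
    simp [isSink_iff]
  rw [this, Set.ncard_pair (by simp)]

/-! ### All state counts, and the asymptotics -/

theorem exists_dfa {n : ℕ} (hn : 22 ≤ n) :
    ∃ (M : SyncDFA (Fin n) (Fin 2)) (S : Set (Fin n)) (l : ℕ),
      M.TransitiveUpToSinks 2 ∧ M.IsSyncLength S l ∧ 3 ^ ((n - 19) / 3 - 1) ≤ l := by
  obtain ⟨e⟩ := nonempty_equiv_fin (k := (n - 19) / 3) (r := (n - 19) % 3) (n := n) (by omega)
  obtain ⟨l, hl⟩ := exists_isSyncLength (k := (n - 19) / 3) (r := (n - 19) % 3) (by omega)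
  refine ⟨(counterDFA _ _).congr e, e '' startSet _ _, l, transitiveUpToSinks.congr e, ?_,
    three_pow_le_of_synchronizesIn (by omega) hl.1⟩
  simpa only [SyncDFA.IsSyncLength, SyncDFA.synchronizesIn_congr] using hl

end CounterState

theorem three_rpow_div_three_le {n l : ℕ} (hn : 22 ≤ n) (hl : 3 ^ ((n - 19) / 3 - 1) ≤ l) :
    (3 : ℝ) ^ ((n : ℝ) / 3) ≤ 3 ^ 8 * (l : ℝ) := by
  calc (3 : ℝ) ^ ((n : ℝ) / 3) ≤ (3 : ℝ) ^ (((8 + ((n - 19) / 3 - 1) : ℕ)) : ℝ) := by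
        refine Real.rpow_le_rpow_of_exponent_le (by norm_num) ?_
        rw [div_le_iff₀ (by norm_num)]
        -- With `k = (n - 19) / 3` one has `n ≤ 3 * k + 21 = 3 * (8 + (k - 1))`, whence the constant
        -- `3 ^ 8`.
        exact_mod_cast (by omega : n ≤ (8 + ((n - 19) / 3 - 1)) * 3)
    _ = 3 ^ 8 * ((3 ^ ((n - 19) / 3 - 1) : ℕ) : ℝ) := by
        rw [Real.rpow_natCast, pow_add]
        push_cast
        rfl
    _ ≤ 3 ^ 8 * (l : ℝ) := by gcongr

theorem mainTheorem6 :
    ∃ (N : ℕ) (M : (n : ℕ) → SyncDFA (Fin n) (Fin 2)) (S : (n : ℕ) → Set (Fin n)) (L : ℕ → ℕ),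
      (∀ n : ℕ, N ≤ n → (M n).TransitiveUpToSinks 2 ∧ (M n).IsSyncLength (S n) (L n)) ∧
      (∀ ε : ℝ, 0 < ε → ε < 3 →
        (fun n : ℕ => (3 - ε) ^ ((n : ℝ) / 3)) =O[atTop] (fun n : ℕ => (L n : ℝ))) ∧
      (fun n : ℕ => (1.4422 : ℝ) ^ n) =O[atTop] (fun n : ℕ => (L n : ℝ)) := by
  have h (n : ℕ) : ∃ (M : SyncDFA (Fin n) (Fin 2)) (S : Set (Fin n)) (l : ℕ), 22 ≤ n →
      M.TransitiveUpToSinks 2 ∧ M.IsSyncLength S l ∧ 3 ^ ((n - 19) / 3 - 1) ≤ l := by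
    by_cases hn : 22 ≤ n
    · obtain ⟨M, S, l, h⟩ := exists_dfa hn
      exact ⟨M, S, l, fun _ => h⟩
    · exact ⟨⟨fun q _ => q⟩, ∅, 0, fun h => absurd h hn⟩
  choose M S L hL using h
  have hO {f : ℕ → ℝ} (h0 : ∀ n, 0 ≤ f n) (hf : ∀ n : ℕ, f n ≤ (3 : ℝ) ^ ((n : ℝ) / 3)) :
      f =O[atTop] (fun n : ℕ => (L n : ℝ)) := by
    refine IsBigO.of_bound (3 ^ 8) ?_
    filter_upwards [eventually_ge_atTop 22] with n hn
    rw [Real.norm_of_nonneg (h0 n), Real.norm_of_nonneg (Nat.cast_nonneg _)]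
    exact (hf n).trans (three_rpow_div_three_le hn (hL n hn).2.2)
  refine ⟨22, M, S, L, fun n hn => ⟨(hL n hn).1, (hL n hn).2.1⟩, fun ε h0 h3 => ?_, ?_⟩
  · exact hO (fun n => Real.rpow_nonneg (by linarith) _)
      fun n => Real.rpow_le_rpow (by linarith) (by linarith) (by positivity)
  · refine hO (fun n => by positivity) fun n => ?_
    calc (1.4422 : ℝ) ^ n = ((1.4422 : ℝ) ^ 3) ^ ((n : ℝ) / 3) := by
          rw [← Real.rpow_natCast, ← Real.rpow_natCast, ← Real.rpow_mul (by norm_num)]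
          congr 1
          push_cast
          ring
      _ ≤ 3 ^ ((n : ℝ) / 3) :=
          Real.rpow_le_rpow (by norm_num) (by norm_num) (by positivity)
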